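/- Let $d\in\{1,2,3,7,11\}$, let $K=\mathbb{Q}(\sqrt{-d})\subset\mathbb{C}$ and let $\mathcal{O}$ be its ring of integers. Let $V=\{z\in\mathbb{C} : |z|<|z-r| \text{ for all } r\in\mathcal{O}\setminus\{0\}\}\cup\mathcal{E}$, where $\mathcal{E}$ is any subset of the boundary of the open Voronoi cell for which $V$ is a strict fundamental domain for the translation action of $\mathcal{O}$ on $\mathbb{C}$. For $z\in\mathbb{C}$ let $\lfloor z\rfloor$ be the unique element of $\mathcal{O}$ with $z-\lfloor z\rfloor\in V$. The nearest integer continued fraction of $z$ has partial quotients $a_n$ and remainders $z_n$ given by $a_0=\lfloor z\rfloor$, $z_0=z-a_0$, $a_{n+1}=\lfloor 1/z_n\rfloor$, $z_{n+1}=1/z_n-a_{n+1}$, and convergents $p_n/q_n$ given by $$\begin{pmatrix}p_n&p_{n-1}\\q_n&q_{n-1}\end{pmatrix}=\begin{pmatrix}a_0&1\\1&0\end{pmatrix}\cdots\begin{pmatrix}a_n&1\\1&0\end{pmatrix}.$$ Put $\rho=\frac{\sqrt{1+d}}{2}$ for $d=1,2$ and $\rho=\frac{1+d}{4\sqrt d}$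 for $d=3,7,11$ (the circumradius of $V$), let $$\kappa=\sup\{|q_n||q_nz-p_n| : z\in\mathbb{C}\setminus K,\ n\ge 0\},$$ and let $\alpha=\alpha_d$ be $$\alpha_1=\frac{1}{\sqrt2-1},\quad \alpha_2=\frac{1}{\sqrt2\sqrt{\frac{486-\sqrt3}{786}}-1},\quad \alpha_3=2,\quad \alpha_7=\frac{1}{\sqrt2\sqrt{\frac{2093-9\sqrt{21}}{2408}}-1},$$ $$\alpha_{11}=\frac{1}{\frac{\sqrt3}{5\sqrt2}\sqrt{30-8\sqrt5-5\sqrt{11}+3\sqrt{55}}-1}$$ (numerically $2.41421\ldots$, $9.08592\ldots$, $2$, $3.27419\ldots$, $30.51490\ldots$). Then $\kappa$ is finite. Moreover, let $$H(z,w)=A|z|^2-B\overline{z}w-\overline{B}z\overline{w}+C|w|^2,\qquad A,C\in\mathbb{Z},\ B\in\mathcal{O},$$ be an integral binary Hermitian form of determinant $\Delta=AC-|B|^2$ that is indefinite (it takes both positive and negative values on $\mathbb{C}^2$) and anisotropic (it has no zero $(z,w)\in K^2$ other than $(0,0)$), and put $$\eta=\max\{|A|,\ |A|\kappa^2+4|B|\kappa+2\kappa\sqrt{-\Delta}\},\qquad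 \beta=\rho+\sqrt{-\Delta}+\sqrt{\eta^2-\Delta},\qquad C'=\frac{1}{\alpha(\beta+1)(\beta+\rho+1)}.$$ Then for every $z\in\mathbb{C}$ with $H(z,1)=0$ and every $n\ge 0$, $$|z_n|\ge\frac{1}{\sqrt{-\Delta}+\sqrt{\eta^2-\Delta}},\qquad |a_n|\le\rho+\sqrt{-\Delta}+\sqrt{\eta^2-\Delta};$$ furthermore $C'>0$, and for every $z\in\mathbb{C}$ with $H(z,1)=0$ and all $p,q\in\mathcal{O}$ with $q\ne0$, $$\left|z-\frac pq\right|\ge\frac{C'}{|q|^2}.$$ -/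

import Mathlib

noncomputable section

open scoped ComplexConjugate

/-- The imaginary quadratic field `K = ℚ(√-d)`, as a subfield of `ℂ`. -/
def quadField (d : ℕ) : IntermediateField ℚ ℂ :=
  IntermediateField.adjoin ℚ {((Real.sqrt d : ℝ) : ℂ) * Complex.I}

/-- The ring of integers `𝒪` of `K = ℚ(√-d)`: the elements of `K` integral over `ℤ`. -/
def quadInt (d : ℕ) : Subring ℂ :=
  (integralClosure ℤ ℂ).toSubring ⊓ (quadField d).toSubring

/-- The open Voronoi cell of the lattice `𝒪` around `0`. -/
def openCell (d : ℕ) : Set ℂ :=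
  {z | ∀ r ∈ quadInt d, r ≠ 0 → ‖z‖ < ‖z - r‖}

/-- `E` is a subset of the boundary of the open Voronoi cell such that `V = openCell d ∪ E` is a
strict fundamental domain for the translation action of `𝒪` on `ℂ`. -/
structure IsBoundaryChoice (d : ℕ) (E : Set ℂ) : Prop where
  subset_frontier : E ⊆ frontier (openCell d)
  existsUnique : ∀ z : ℂ, ∃! a : ℂ, a ∈ quadInt d ∧ z - a ∈ openCell d ∪ E

open Classical in
/-- The nearest integer `⌊z⌋ ∈ 𝒪`, characterised by `z - ⌊z⌋ ∈ V = openCell d ∪ E`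
(the value `0` is never used when `E` is a boundary choice). -/
def nearestInt (d : ℕ) (E : Set ℂ) (z : ℂ) : ℂ :=
  if h : ∃ a : ℂ, a ∈ quadInt d ∧ z - a ∈ openCell d ∪ E then h.choose else 0

/-- The remainders `z_n`: `z_0 = z - ⌊z⌋` and `z_{n+1} = 1 / z_n - ⌊1 / z_n⌋`. -/
def cfRem (d : ℕ) (E : Set ℂ) (z : ℂ) : ℕ → ℂ
  | 0 => z - nearestInt d E z
  | n + 1 => 1 / cfRem d E z n - nearestInt d E (1 / cfRem d E z n)

/-- The partial quotients `a_n`: `a_0 = ⌊z⌋` and `a_{n+1} = ⌊1 / z_n⌋`. -/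
def cfQuot (d : ℕ) (E : Set ℂ) (z : ℂ) : ℕ → ℂ
  | 0 => nearestInt d E z
  | n + 1 => nearestInt d E (1 / cfRem d E z n)

/-- The product of the matrices `(a_i, 1; 1, 0)` for `i = 0, …, n`, which is
`(p_n, p_{n-1}; q_n, q_{n-1})`. -/
def cfMat (d : ℕ) (E : Set ℂ) (z : ℂ) : ℕ → Matrix (Fin 2) (Fin 2) ℂ
  | 0 => !![cfQuot d E z 0, 1; 1, 0]
  | n + 1 => cfMat d E z n * !![cfQuot d E z (n + 1), 1; 1, 0]

/-- Numerator `p_n` of the `n`-th convergent. -/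
def cfNum (d : ℕ) (E : Set ℂ) (z : ℂ) (n : ℕ) : ℂ := cfMat d E z n 0 0

/-- Denominator `q_n` of the `n`-th convergent. -/
def cfDen (d : ℕ) (E : Set ℂ) (z : ℂ) (n : ℕ) : ℂ := cfMat d E z n 1 0

/-- The values `|q_n| |q_n z - p_n|` for `z ∈ ℂ ∖ K` and `n ≥ 0`. -/
def kappaSet (d : ℕ) (E : Set ℂ) : Set ℝ :=
  {x | ∃ z : ℂ, z ∉ quadField d ∧ ∃ n : ℕ,
    x = ‖cfDen d E z n‖ * ‖cfDen d E z n * z - cfNum d E z n‖}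

/-- `κ = sup_{z, n} |q_n| |q_n z - p_n|`. -/
def kappa (d : ℕ) (E : Set ℂ) : ℝ := sSup (kappaSet d E)

/-- The circumradius `ρ_d` of the Voronoi cell, for `d = 1, 2, 3, 7, 11`. -/
def rho (d : ℕ) : ℝ :=
  if d = 1 ∨ d = 2 then Real.sqrt (1 + d) / 2 else (1 + d) / (4 * Real.sqrt d)

/-- The constants `α_d`, approximately `2.41421`, `9.08592`, `2`, `3.27419`, `30.51490` for
`d = 1, 2, 3, 7, 11` respectively. -/
def alpha (d : ℕ) : ℝ :=
  if d = 1 then 1 / (√2 - 1)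
  else if d = 2 then 1 / (√2 * √((486 - √3) / 786) - 1)
  else if d = 3 then 2
  else if d = 7 then 1 / (√2 * √((2093 - 9 * √21) / 2408) - 1)
  else 1 / (√3 * (1 / (5 * √2) * √(30 - 8 * √5 - 5 * √11 + 3 * √55)) - 1)

/-- A binary Hermitian form, with Hermitian matrix `(A, -B; -conj B, C)`. -/
structure BinHermForm where
  A : ℝ
  B : ℂ
  C : ℝ

namespace BinHermForm

/-- The Hermitian matrix of the form. -/
def toMatrix (H : BinHermForm) : Matrix (Fin 2) (Fin 2) ℂ :=
  !![(H.A : ℂ), -H.B; -conj H.B, (H.C : ℂ)]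

/-- The (real) value `H(z, w)`; see `coe_eval`. -/
def eval (H : BinHermForm) (z w : ℂ) : ℝ :=
  H.A * Complex.normSq z - 2 * (H.B * conj z * w).re + H.C * Complex.normSq w

theorem coe_eval (H : BinHermForm) (z w : ℂ) :
    (H.eval z w : ℂ) =
      H.A * z * conj z - H.B * conj z * w - conj H.B * z * conj w + H.C * w * conj w := by
  apply Complex.ext <;> simp [eval, Complex.normSq_apply] <;> ring

/-- The determinant `Δ = A C - |B|²`. -/
def disc (H : BinHermForm) : ℝ := H.A * H.C - Complex.normSq H.B

theorem det_toMatrix (H : BinHermForm) : H.toMatrix.det = (H.disc : ℂ) := by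
  simp [toMatrix, disc, Matrix.det_fin_two_of, Complex.mul_conj]

/-- `H` is integral over `K`: `A, C ∈ ℤ` and `B ∈ 𝒪`. -/
def IsIntegralOver (d : ℕ) (H : BinHermForm) : Prop :=
  (∃ a : ℤ, H.A = a) ∧ (∃ c : ℤ, H.C = c) ∧ H.B ∈ quadInt d

/-- `H` takes both positive and negative values. -/
def IsIndefinite (H : BinHermForm) : Prop :=
  (∃ z w : ℂ, 0 < H.eval z w) ∧ (∃ z w : ℂ, H.eval z w < 0)

/-- `H` has no nontrivial zero over `K`. -/
def IsAnisotropic (d : ℕ) (H : BinHermForm) : Prop :=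
  ∀ z ∈ quadField d, ∀ w ∈ quadField d, H.eval z w = 0 → z = 0 ∧ w = 0

/-- The affine part of the zero set `Z(H)`: those `z` for which `[z : 1]` is a zero of `H`. -/
def zeroSet (H : BinHermForm) : Set ℂ := {z | H.eval z 1 = 0}

/-- `η = max {|A|, |A| κ² + 4 |B| κ + 2 κ √(-Δ)}`. -/
def eta (d : ℕ) (E : Set ℂ) (H : BinHermForm) : ℝ :=
  max |H.A| (|H.A| * kappa d E ^ 2 + 4 * ‖H.B‖ * kappa d E + 2 * kappa d E * √(-H.disc))

/-- `β = ρ + √(-Δ) + √(η² - Δ)`. -/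
def beta (d : ℕ) (E : Set ℂ) (H : BinHermForm) : ℝ :=
  rho d + √(-H.disc) + √(H.eta d E ^ 2 - H.disc)

/-- `C' = 1 / (α (β + 1) (β + ρ + 1))`. -/
def approxConst (d : ℕ) (E : Set ℂ) (H : BinHermForm) : ℝ :=
  1 / (alpha d * (H.beta d E + 1) * (H.beta d E + rho d + 1))

end BinHermForm

end

open scoped ComplexConjugate

/-! ### The field and its ring of integers -/

/-! Everything about the algorithm rests on `rho d < 1`. With P_n = q_n + q_{n-1} z_n one has |P_n|
|q_n z - p_n| = |z_n| (determinant ±1) and P_n = z_n P_{n+1}; the second gives (1 - ρ²)|q_n| ≤ |P_n|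
by induction, so κ ≤ ρ/(1 - ρ²) (`bddAbove_kappaSet`).

For a zero z of H, pull H back by the n-th convergent matrix. The new form H' has the same Δ,
vanishes at 1/z_n, and has outer coefficients H(p_n, q_n) and H(p_{n-1}, q_{n-1}), bounded by η
because the convergents approximate z to quality κ. Then |B'|² = A'C' - Δ ≤ η² - Δ, and |A'| ≥ 1 by
integrality and anisotropy. Since |A'x - B'| = √(-Δ) at zeros x of H', 1/z_n is bounded
(`norm_inv_cfRem_le`), and a_n differs from 1/z_{n-1} (or from z, if n = 0) by at most ρ.

The approximation bound is a Liouville argument that needs no convergents: 1 ≤ |H(p, q)|, while H(p,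
q) is small when p/q is close to z (`one_le_mul_norm_mul`). This gives the constant 1/(√(-Δ) + √(η²
- Δ)), which is at least C' as soon as α ≥ 1. -/

theorem exists_rat_of_mem_quadField {d : ℕ} {x : ℂ} (hx : x ∈ quadField d) :
    ∃ a b : ℚ, x = a + b * ((Real.sqrt d : ℝ) * Complex.I) := by
  have hθ : ((Real.sqrt d : ℝ) * Complex.I) * ((Real.sqrt d : ℝ) * Complex.I) = -(d : ℂ) := by
    have h : ((Real.sqrt d : ℝ) : ℂ) * (Real.sqrt d : ℝ) = (d : ℂ) := by
      rw [← Complex.ofReal_mul, Real.mul_self_sqrt (Nat.cast_nonneg d), Complex.ofReal_natCast]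
    linear_combination (Complex.I * Complex.I) * h + (d : ℂ) * Complex.I_mul_I
  unfold quadField at hx
  induction hx using IntermediateField.adjoin_induction with
  | mem x hx =>
    rw [Set.mem_singleton_iff] at hx
    exact ⟨0, 1, by simp [hx]⟩
  | algebraMap x => exact ⟨x, 0, by simp⟩
  | add x y _ _ hx hy =>
    obtain ⟨a, b, rfl⟩ := hx
    obtain ⟨a', b', rfl⟩ := hy
    exact ⟨a + a', b + b', by push_cast; ring⟩
  | mul x y _ _ hx hy =>
    obtain ⟨a, b, rfl⟩ := hx
    obtain ⟨a', b', rfl⟩ := hy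
    exact ⟨a * a' - d * b * b', a * b' + a' * b, by
      push_cast; linear_combination (b * b' : ℂ) * hθ⟩
  | inv x _ hx =>
    obtain ⟨a, b, rfl⟩ := hx
    have hn : Complex.normSq ((a : ℂ) + b * ((Real.sqrt d : ℝ) * Complex.I)) =
        ((a ^ 2 + d * b ^ 2 : ℚ) : ℝ) := by
      have h := Real.mul_self_sqrt (Nat.cast_nonneg (α := ℝ) d)
      simp [Complex.normSq_apply]
      linear_combination (b * b : ℝ) * h
    refine ⟨a / (a ^ 2 + d * b ^ 2), -b / (a ^ 2 + d * b ^ 2), ?_⟩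
    rw [Complex.inv_def, hn]
    simp
    ring

theorem conj_mem_quadField {d : ℕ} {x : ℂ} (hx : x ∈ quadField d) : conj x ∈ quadField d := by
  obtain ⟨a, b, rfl⟩ := exists_rat_of_mem_quadField hx
  have hθ : ((Real.sqrt d : ℝ) : ℂ) * Complex.I ∈ quadField d :=
    IntermediateField.subset_adjoin _ _ (Set.mem_singleton _)
  have h : conj ((a : ℂ) + b * ((Real.sqrt d : ℝ) * Complex.I)) =
      (a : ℂ) + -(b * ((Real.sqrt d : ℝ) * Complex.I)) := by simp
  rw [h]
  exact add_mem (SubfieldClass.ratCast_mem _ a)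
    (neg_mem (mul_mem (SubfieldClass.ratCast_mem _ b) hθ))

theorem mem_quadInt_iff {d : ℕ} {x : ℂ} : x ∈ quadInt d ↔ IsIntegral ℤ x ∧ x ∈ quadField d :=
  Iff.rfl

theorem conj_mem_quadInt {d : ℕ} {x : ℂ} (hx : x ∈ quadInt d) : conj x ∈ quadInt d := by
  rw [mem_quadInt_iff] at hx ⊢
  exact ⟨map_isIntegral_int (starRingEnd ℂ) hx.1, conj_mem_quadField hx.2⟩

theorem exists_int_of_isIntegral_ratCast {r : ℚ} (h : IsIntegral ℤ (r : ℂ)) :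
    ∃ n : ℤ, r = n := by
  have h' : IsIntegral ℤ r :=
    (isIntegral_algebraMap_iff (algebraMap ℚ ℂ).injective).1 (by simpa using h)
  obtain ⟨n, hn⟩ := IsIntegrallyClosed.isIntegral_iff.1 h'
  exact ⟨n, by simpa using hn.symm⟩

/-- The trace x + conj x is rational and integral over ℤ, which is integrally closed. -/
theorem exists_int_two_mul_re {d : ℕ} {x : ℂ} (hx : x ∈ quadInt d) :
    ∃ n : ℤ, 2 * x.re = n := by
  obtain ⟨a, b, hab⟩ := exists_rat_of_mem_quadField hx.2
  have hre : x.re = a := by simp [hab]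
  have h : IsIntegral ℤ (((2 * a : ℚ)) : ℂ) := by
    have : IsIntegral ℤ (x + conj x) := (add_mem hx (conj_mem_quadInt hx)).1
    rw [Complex.add_conj, hre] at this
    simpa using this
  obtain ⟨n, hn⟩ := exists_int_of_isIntegral_ratCast h
  exact ⟨n, by rw [hre]; exact_mod_cast hn⟩

theorem exists_int_normSq {d : ℕ} {x : ℂ} (hx : x ∈ quadInt d) :
    ∃ n : ℤ, Complex.normSq x = n := by
  obtain ⟨n, hn⟩ := exists_int_two_mul_re (mul_mem hx (conj_mem_quadInt hx))
  obtain ⟨a, b, hab⟩ := exists_rat_of_mem_quadField hx.2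
  have hns : Complex.normSq x = ((a ^ 2 + d * b ^ 2 : ℚ) : ℝ) := by
    have h := Real.mul_self_sqrt (Nat.cast_nonneg (α := ℝ) d)
    simp [hab, Complex.normSq_apply]
    linear_combination (b * b : ℝ) * h
  have h : IsIntegral ℤ (((a ^ 2 + d * b ^ 2 : ℚ)) : ℂ) := by
    have : IsIntegral ℤ (x * conj x) := (mul_mem hx (conj_mem_quadInt hx)).1
    rw [Complex.mul_conj, hns] at this
    simpa using this
  obtain ⟨n, hn⟩ := exists_int_of_isIntegral_ratCast h
  exact ⟨n, by rw [hns]; exact_mod_cast hn⟩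

theorem one_le_norm_of_mem_quadInt {d : ℕ} {x : ℂ} (hx : x ∈ quadInt d) (h0 : x ≠ 0) :
    1 ≤ ‖x‖ := by
  obtain ⟨n, hn⟩ := exists_int_normSq hx
  have hpos : 0 < n := by exact_mod_cast hn ▸ Complex.normSq_pos.2 h0
  have h1 : (1 : ℝ) ≤ n := by exact_mod_cast hpos
  rw [← hn, Complex.normSq_eq_norm_sq] at h1
  nlinarith [norm_nonneg x]

theorem sqrt_mul_I_mem_quadInt (d : ℕ) : ((Real.sqrt d : ℝ) : ℂ) * Complex.I ∈ quadInt d := by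
  rw [mem_quadInt_iff]
  refine ⟨⟨Polynomial.X ^ 2 + Polynomial.C (d : ℤ),
    Polynomial.monic_X_pow_add_C _ two_ne_zero, ?_⟩,
    IntermediateField.subset_adjoin _ _ (Set.mem_singleton _)⟩
  have h : ((Real.sqrt d : ℝ) : ℂ) ^ 2 = (d : ℂ) := by
    rw [← Complex.ofReal_pow, Real.sq_sqrt (Nat.cast_nonneg d), Complex.ofReal_natCast]
  simp [mul_pow, h]

theorem half_mem_quadInt {d k : ℕ} (hk : d + 1 = 4 * k) :
    (1 + ((Real.sqrt d : ℝ) : ℂ) * Complex.I) / 2 ∈ quadInt d := by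
  have hθ : ((Real.sqrt d : ℝ) : ℂ) * Complex.I ∈ quadField d :=
    IntermediateField.subset_adjoin _ _ (Set.mem_singleton _)
  rw [mem_quadInt_iff]
  refine ⟨⟨Polynomial.X ^ 2 - Polynomial.X + Polynomial.C (k : ℤ), by monicity!, ?_⟩,
    div_mem (add_mem (one_mem _) hθ) (ofNat_mem _ 2)⟩
  have h : ((Real.sqrt d : ℝ) : ℂ) ^ 2 = (d : ℂ) := by
    rw [← Complex.ofReal_pow, Real.sq_sqrt (Nat.cast_nonneg d), Complex.ofReal_natCast]
  have hk' : (d : ℂ) + 1 = 4 * k := by exact_mod_cast hk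
  simp
  linear_combination (Complex.I ^ 2 / 4) * h + (d / 4 : ℂ) * Complex.I_sq - hk' / 4

/-! ### The Voronoi cell -/

/-- The inequalities defining the open cell become closed conditions when weakened, so they survive
on its frontier. -/
theorem IsBoundaryChoice.norm_le_norm_sub {d : ℕ} {E : Set ℂ} (hE : IsBoundaryChoice d E) {z : ℂ}
    (hz : z ∈ openCell d ∪ E) {r : ℂ} (hr : r ∈ quadInt d) : ‖z‖ ≤ ‖z - r‖ := by
  rcases eq_or_ne r 0 with rfl | h0
  · simp
  have hcl : z ∈ closure (openCell d) := by
    rcases hz with h | h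
    · exact subset_closure h
    · exact frontier_subset_closure (hE.subset_frontier h)
  have hclosed : IsClosed {z : ℂ | ‖z‖ ≤ ‖z - r‖} :=
    isClosed_le continuous_norm (continuous_id.sub continuous_const).norm
  exact closure_minimal (fun w hw => (hw r hr h0).le) hclosed hcl

theorem two_mul_inner_le_of_norm_le_norm_sub {z r : ℂ} (h : ‖z‖ ≤ ‖z - r‖) :
    2 * (z.re * r.re + z.im * r.im) ≤ r.re ^ 2 + r.im ^ 2 := by
  have h2 : ‖z‖ ^ 2 ≤ ‖z - r‖ ^ 2 := pow_le_pow_left₀ (norm_nonneg _) h 2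
  rw [← Complex.normSq_eq_norm_sq, ← Complex.normSq_eq_norm_sq, Complex.normSq_apply,
    Complex.normSq_apply, Complex.sub_re, Complex.sub_im] at h2
  nlinarith

theorem rho_nonneg (d : ℕ) : 0 ≤ rho d := by
  unfold rho
  split_ifs <;> positivity

theorem rho_lt_one {d : ℕ} (hd : d ∈ ({1, 2, 3, 7, 11} : Set ℕ)) : rho d < 1 := by
  have half {x : ℝ} (hx : x < 4) : √x / 2 < 1 := by
    rw [div_lt_one two_pos, Real.sqrt_lt' two_pos]
    linarith
  have quot {x : ℝ} (hx : 0 < x) (h : (1 + x) ^ 2 < 16 * x) : (1 + x) / (4 * √x) < 1 := by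
    have hs := Real.sqrt_pos.2 hx
    rw [div_lt_one (by positivity)]
    refine lt_of_pow_lt_pow_left₀ 2 (by positivity) ?_
    rw [mul_pow, Real.sq_sqrt hx.le]
    linarith
  rcases hd with rfl | rfl | rfl | rfl | rfl <;> simp only [rho] <;> norm_num
  · simpa using half (x := 2) (by norm_num)
  · exact half (by norm_num)
  · have := quot (x := 3) (by norm_num) (by norm_num)
    norm_num at this; exact this
  · have := quot (x := 7) (by norm_num) (by norm_num)
    norm_num at this; exact this
  · have := quot (x := 11) (by norm_num) (by norm_num)
    norm_num at this; exact this

/-- The lattice points ±1 and ±√(-d) confine z to a rectangle with half-diagonal √(1 + d)/2. -/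
theorem norm_le_sqrt_div_two {d : ℕ} {z : ℂ} (hz : ∀ r ∈ quadInt d, ‖z‖ ≤ ‖z - r‖)
    (hd : 0 < d) : ‖z‖ ≤ √(1 + d) / 2 := by
  have hdpos : (0 : ℝ) < d := by exact_mod_cast hd
  have hs := Real.sqrt_pos.2 hdpos
  have hs2 := Real.sq_sqrt hdpos.le
  have h1 := two_mul_inner_le_of_norm_le_norm_sub (hz 1 (one_mem _))
  have h2 := two_mul_inner_le_of_norm_le_norm_sub (hz (-1) (neg_mem (one_mem _)))
  have h3 := two_mul_inner_le_of_norm_le_norm_sub (hz _ (sqrt_mul_I_mem_quadInt d))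
  have h4 := two_mul_inner_le_of_norm_le_norm_sub (hz _ (neg_mem (sqrt_mul_I_mem_quadInt d)))
  simp at h1 h2 h3 h4
  have hx : z.re ^ 2 ≤ (1 / 2) ^ 2 := by
    rw [sq_le_sq, abs_of_pos (one_half_pos (α := ℝ)), abs_le]
    constructor <;> linarith
  have hy : z.im ^ 2 ≤ (√d / 2) ^ 2 := by
    rw [sq_le_sq, abs_of_pos (half_pos hs), abs_le]
    constructor <;> nlinarith
  refine le_of_sq_le_sq ?_ (by positivity)
  rw [div_pow, Real.sq_sqrt (by positivity), ← Complex.normSq_eq_norm_sq, Complex.normSq_apply]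
  rw [div_pow, hs2] at hy
  linarith

/-- With ω = (1 + √(-d))/2, the points ±1, ±ω and ± conj ω confine z to a hexagon; the bound is its
circumradius. -/
theorem norm_le_div_four_mul_sqrt {d k : ℕ} {z : ℂ} (hz : ∀ r ∈ quadInt d, ‖z‖ ≤ ‖z - r‖)
    (hk : d + 1 = 4 * k) (hd : 0 < d) : ‖z‖ ≤ (1 + d) / (4 * √d) := by
  have hdpos : (0 : ℝ) < d := by exact_mod_cast hd
  have hs := Real.sqrt_pos.2 hdpos
  have hs2 := Real.sq_sqrt hdpos.le
  have hω := half_mem_quadInt hk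
  have h1 := two_mul_inner_le_of_norm_le_norm_sub (hz 1 (one_mem _))
  have h2 := two_mul_inner_le_of_norm_le_norm_sub (hz (-1) (neg_mem (one_mem _)))
  have h3 := two_mul_inner_le_of_norm_le_norm_sub (hz _ hω)
  have h4 := two_mul_inner_le_of_norm_le_norm_sub (hz _ (neg_mem hω))
  have h5 := two_mul_inner_le_of_norm_le_norm_sub (hz _ (conj_mem_quadInt hω))
  have h6 := two_mul_inner_le_of_norm_le_norm_sub (hz _ (neg_mem (conj_mem_quadInt hω)))
  rw [Complex.conj_re, Complex.conj_im] at h5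
  rw [Complex.neg_re, Complex.neg_im, Complex.conj_re, Complex.conj_im] at h6
  simp at h1 h2 h3 h4 h5 h6
  have hX : |z.re| ≤ 1 / 2 := abs_le.2 ⟨by linarith, by linarith⟩
  have hY : √d * |z.im| ≤ (1 + d) / 4 - |z.re| := by
    rcases abs_cases z.re with ⟨e, _⟩ | ⟨e, _⟩ <;> rcases abs_cases z.im with ⟨f, _⟩ | ⟨f, _⟩ <;>
      rw [e, f] <;> nlinarith
  have hY2 : d * z.im ^ 2 ≤ ((1 + d) / 4 - |z.re|) ^ 2 := by
    have := pow_le_pow_left₀ (by positivity) hY 2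
    rwa [mul_pow, hs2, sq_abs] at this
  refine le_of_sq_le_sq ?_ (by positivity)
  rw [div_pow, mul_pow, hs2, ← Complex.normSq_eq_norm_sq, Complex.normSq_apply,
    le_div_iff₀ (by positivity)]
  have hXX : z.re * z.re = |z.re| ^ 2 := by rw [sq_abs, sq]
  rw [hXX]
  -- With X = |Re z|, d X² + ((1 + d)/4 - X)² = ((1 + d)/4)² - (1 + d) X (1/2 - X), and the last
  -- product is nonnegative; it vanishes at the vertices.
  nlinarith [mul_nonneg (mul_nonneg (by positivity : (0 : ℝ) ≤ 1 + d) (abs_nonneg z.re))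
    (sub_nonneg.2 hX)]

theorem IsBoundaryChoice.norm_le_rho {d : ℕ} (hd : d ∈ ({1, 2, 3, 7, 11} : Set ℕ)) {E : Set ℂ}
    (hE : IsBoundaryChoice d E) {z : ℂ} (hz : z ∈ openCell d ∪ E) : ‖z‖ ≤ rho d := by
  have h : ∀ r ∈ quadInt d, ‖z‖ ≤ ‖z - r‖ := fun r hr => hE.norm_le_norm_sub hz hr
  rcases hd with rfl | rfl | rfl | rfl | rfl
  · simpa [rho] using norm_le_sqrt_div_two h (by norm_num)
  · simpa [rho] using norm_le_sqrt_div_two h (by norm_num)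
  · simpa [rho] using norm_le_div_four_mul_sqrt (k := 1) h (by norm_num) (by norm_num)
  · simpa [rho] using norm_le_div_four_mul_sqrt (k := 2) h (by norm_num) (by norm_num)
  · simpa [rho] using norm_le_div_four_mul_sqrt (k := 3) h (by norm_num) (by norm_num)

/-! ### The continued fraction algorithm -/

section ContinuedFraction

variable {d : ℕ} {E : Set ℂ}

theorem IsBoundaryChoice.nearestInt_spec (hE : IsBoundaryChoice d E) (z : ℂ) :
    nearestInt d E z ∈ quadInt d ∧ z - nearestInt d E z ∈ openCell d ∪ E := by
  have h := (hE.existsUnique z).exists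
  rw [nearestInt, dif_pos h]
  exact h.choose_spec

theorem IsBoundaryChoice.cfQuot_mem (hE : IsBoundaryChoice d E) (z : ℂ) (n : ℕ) :
    cfQuot d E z n ∈ quadInt d := by
  cases n <;> exact (hE.nearestInt_spec _).1

theorem IsBoundaryChoice.cfRem_mem (hE : IsBoundaryChoice d E) (z : ℂ) (n : ℕ) :
    cfRem d E z n ∈ openCell d ∪ E := by
  cases n <;> exact (hE.nearestInt_spec _).2

theorem cfRem_succ (z : ℂ) (n : ℕ) :
    cfRem d E z (n + 1) = 1 / cfRem d E z n - cfQuot d E z (n + 1) := rfl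

theorem cfRem_not_mem (hE : IsBoundaryChoice d E) {z : ℂ} (hz : z ∉ quadField d) (n : ℕ) :
    cfRem d E z n ∉ quadField d := by
  induction n with
  | zero =>
    intro h
    apply hz
    have := add_mem h (hE.cfQuot_mem z 0).2
    rwa [cfRem, cfQuot, sub_add_cancel] at this
  | succ n ih =>
    intro h
    apply ih
    have := inv_mem (add_mem h (hE.cfQuot_mem z (n + 1)).2)
    rwa [cfRem_succ, sub_add_cancel, one_div, inv_inv] at this

theorem cfRem_ne_zero (hE : IsBoundaryChoice d E) {z : ℂ} (hz : z ∉ quadField d) (n : ℕ) :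
    cfRem d E z n ≠ 0 :=
  fun h => cfRem_not_mem hE hz n (h ▸ zero_mem _)

theorem cfMat_succ_zero_zero (z : ℂ) (n : ℕ) : cfMat d E z (n + 1) 0 0 =
    cfMat d E z n 0 0 * cfQuot d E z (n + 1) + cfMat d E z n 0 1 := by
  simp [cfMat, Matrix.mul_apply, Fin.sum_univ_two]

theorem cfMat_succ_one_zero (z : ℂ) (n : ℕ) : cfMat d E z (n + 1) 1 0 =
    cfMat d E z n 1 0 * cfQuot d E z (n + 1) + cfMat d E z n 1 1 := by
  simp [cfMat, Matrix.mul_apply, Fin.sum_univ_two]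

theorem cfMat_succ_one (z : ℂ) (n : ℕ) (i : Fin 2) :
    cfMat d E z (n + 1) i 1 = cfMat d E z n i 0 := by
  simp [cfMat, Matrix.mul_apply, Fin.sum_univ_two]

theorem cfMat_mem (hE : IsBoundaryChoice d E) (z : ℂ) (n : ℕ) (i j : Fin 2) :
    cfMat d E z n i j ∈ quadInt d := by
  induction n generalizing i j with
  | zero =>
    fin_cases i <;> fin_cases j <;>
      simp [cfMat, one_mem, zero_mem, hE.cfQuot_mem]
  | succ n ih =>
    fin_cases j
    · have := add_mem (mul_mem (ih i 0) (hE.cfQuot_mem z (n + 1))) (ih i 1)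
      fin_cases i
      · exact cfMat_succ_zero_zero (d := d) (E := E) z n ▸ this
      · exact cfMat_succ_one_zero (d := d) (E := E) z n ▸ this
    · exact cfMat_succ_one (d := d) (E := E) z n i ▸ ih i 0

theorem norm_det_cfMat (z : ℂ) (n : ℕ) : ‖(cfMat d E z n).det‖ = 1 := by
  induction n with
  | zero => simp [cfMat, Matrix.det_fin_two_of]
  | succ n ih => rw [cfMat, Matrix.det_mul, norm_mul, ih]; simp [Matrix.det_fin_two_of]

/-- Division-free form of z = (p_n + p_{n-1} z_n)/(q_n + q_{n-1} z_n). -/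
theorem cfMat_mul_cfRem (hE : IsBoundaryChoice d E) {z : ℂ} (hz : z ∉ quadField d) (n : ℕ) :
    cfMat d E z n 0 0 + cfMat d E z n 0 1 * cfRem d E z n =
      z * (cfMat d E z n 1 0 + cfMat d E z n 1 1 * cfRem d E z n) := by
  induction n with
  | zero => simp [cfMat, cfQuot, cfRem]
  | succ n ih =>
    have h0 := cfRem_ne_zero hE hz n
    rw [cfMat_succ_zero_zero, cfMat_succ_one_zero, cfMat_succ_one, cfMat_succ_one, cfRem_succ]
    field_simp
    linear_combination ih

/-! ### Upper and lower bounds for κ -/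

theorem cfDen_add_succ (hE : IsBoundaryChoice d E) {z : ℂ} (hz : z ∉ quadField d) (n : ℕ) :
    cfMat d E z n 1 0 + cfMat d E z n 1 1 * cfRem d E z n =
      cfRem d E z n * (cfMat d E z (n + 1) 1 0 + cfMat d E z (n + 1) 1 1 * cfRem d E z (n + 1)) := by
  have h0 := cfRem_ne_zero hE hz n
  rw [cfMat_succ_one_zero, cfMat_succ_one, cfRem_succ]
  field_simp
  ring

theorem norm_cfDen_add_mul (hE : IsBoundaryChoice d E) {z : ℂ} (hz : z ∉ quadField d) (n : ℕ) :
    ‖cfMat d E z n 1 0 + cfMat d E z n 1 1 * cfRem d E z n‖ *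
      ‖cfDen d E z n * z - cfNum d E z n‖ = ‖cfRem d E z n‖ := by
  rw [← norm_mul, ← one_mul ‖cfRem d E z n‖, ← norm_det_cfMat (d := d) (E := E) z n, ← norm_mul,
    ← norm_neg (_ * cfRem d E z n), Matrix.det_fin_two, cfDen, cfNum]
  congr 1
  linear_combination -cfMat d E z n 1 0 * cfMat_mul_cfRem hE hz n

/-- Induction using |P_n| ≤ ρ |P_{n+1}| and q_{n+1} = P_{n+1} - z_{n+1} q_n, where P_n is the
right-hand side without the norm. No monotonicity of |q_n| is needed. -/
theorem norm_cfDen_le (hd : d ∈ ({1, 2, 3, 7, 11} : Set ℕ)) (hE : IsBoundaryChoice d E) {z : ℂ}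
    (hz : z ∉ quadField d) (n : ℕ) : (1 - rho d ^ 2) * ‖cfDen d E z n‖ ≤
      ‖cfMat d E z n 1 0 + cfMat d E z n 1 1 * cfRem d E z n‖ := by
  have hr0 := rho_nonneg d
  have hr1 := rho_lt_one hd
  induction n with
  | zero => simp [cfDen, cfMat, sq_nonneg]
  | succ n ih =>
    set P := cfMat d E z n 1 0 + cfMat d E z n 1 1 * cfRem d E z n with hP
    set P' := cfMat d E z (n + 1) 1 0 + cfMat d E z (n + 1) 1 1 * cfRem d E z (n + 1) with hP'
    have hPP : ‖P‖ ≤ rho d * ‖P'‖ := by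
      rw [hP, cfDen_add_succ hE hz n, norm_mul]
      exact mul_le_mul_of_nonneg_right (hE.norm_le_rho hd (hE.cfRem_mem z n)) (norm_nonneg _)
    have hq : ‖cfDen d E z (n + 1)‖ ≤ ‖P'‖ + rho d * ‖cfDen d E z n‖ := by
      have h : cfDen d E z (n + 1) = P' - cfRem d E z (n + 1) * cfDen d E z n := by
        rw [hP', cfMat_succ_one, cfDen, cfDen]
        ring
      rw [h]
      refine (norm_sub_le _ _).trans ?_
      rw [norm_mul]
      gcongr
      exact hE.norm_le_rho hd (hE.cfRem_mem z (n + 1))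
    have h1 : 0 < 1 - rho d ^ 2 := by nlinarith
    calc (1 - rho d ^ 2) * ‖cfDen d E z (n + 1)‖
        ≤ (1 - rho d ^ 2) * (‖P'‖ + rho d * ‖cfDen d E z n‖) := by gcongr
      _ = (1 - rho d ^ 2) * ‖P'‖ + rho d * ((1 - rho d ^ 2) * ‖cfDen d E z n‖) := by ring
      _ ≤ (1 - rho d ^ 2) * ‖P'‖ + rho d * (rho d * ‖P'‖) :=
        add_le_add_right (mul_le_mul_of_nonneg_left (ih.trans hPP) hr0) _
      _ = ‖P'‖ := by ring

theorem bddAbove_kappaSet (hd : d ∈ ({1, 2, 3, 7, 11} : Set ℕ)) (hE : IsBoundaryChoice d E) :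
    BddAbove (kappaSet d E) := by
  have hr0 := rho_nonneg d
  have hr1 := rho_lt_one hd
  have h1 : 0 < 1 - rho d ^ 2 := by nlinarith
  refine ⟨rho d / (1 - rho d ^ 2), ?_⟩
  rintro x ⟨z, hz, n, rfl⟩
  rw [le_div_iff₀ h1]
  calc ‖cfDen d E z n‖ * ‖cfDen d E z n * z - cfNum d E z n‖ * (1 - rho d ^ 2)
      = (1 - rho d ^ 2) * ‖cfDen d E z n‖ * ‖cfDen d E z n * z - cfNum d E z n‖ := by ring
    _ ≤ ‖cfMat d E z n 1 0 + cfMat d E z n 1 1 * cfRem d E z n‖ *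
        ‖cfDen d E z n * z - cfNum d E z n‖ := by
      gcongr
      exact norm_cfDen_le hd hE hz n
    _ = ‖cfRem d E z n‖ := norm_cfDen_add_mul hE hz n
    _ ≤ rho d := hE.norm_le_rho hd (hE.cfRem_mem z n)

theorem mem_openCell_of_norm_lt_half {z : ℂ} (hz : ‖z‖ < 1 / 2) : z ∈ openCell d := by
  intro r hr h0
  have h1 := one_le_norm_of_mem_quadInt hr h0
  have h2 := norm_sub_norm_le r z
  rw [norm_sub_rev] at h2
  linarith

theorem sqrt_two_div_four_not_mem_quadField : ((√2 / 4 : ℝ) : ℂ) ∉ quadField d := by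
  intro h
  obtain ⟨a, b, hab⟩ := exists_rat_of_mem_quadField h
  have hre := congrArg Complex.re hab
  simp at hre
  refine irrational_sqrt_two ⟨4 * a, ?_⟩
  push_cast
  linarith

/-- The witness √2/4 is outside K and within 1/2 of the origin, so a_0 = 0 and n = 0 contributes
√2/4. This makes 4|B|κ ≥ |B| in η. -/
theorem one_fourth_le_kappa (hd : d ∈ ({1, 2, 3, 7, 11} : Set ℕ)) (hE : IsBoundaryChoice d E) :
    1 / 4 ≤ kappa d E := by
  have hs0 := Real.sqrt_nonneg 2
  have hs := Real.sq_sqrt (zero_le_two (α := ℝ))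
  have hnorm : ‖((√2 / 4 : ℝ) : ℂ)‖ = √2 / 4 := by
    rw [Complex.norm_real, Real.norm_eq_abs, abs_of_nonneg (by positivity)]
  have hcell : ((√2 / 4 : ℝ) : ℂ) ∈ openCell d :=
    mem_openCell_of_norm_lt_half (by rw [hnorm]; nlinarith)
  have hint : nearestInt d E ((√2 / 4 : ℝ) : ℂ) = 0 :=
    (hE.existsUnique _).unique (hE.nearestInt_spec _)
      ⟨zero_mem _, by rw [sub_zero]; exact Or.inl hcell⟩
  have hmem : √2 / 4 ∈ kappaSet d E := by
    refine ⟨((√2 / 4 : ℝ) : ℂ), sqrt_two_div_four_not_mem_quadField, 0, ?_⟩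
    simp only [cfDen, cfNum, cfMat, cfQuot, hint]
    simpa using hnorm.symm
  refine le_trans ?_ (le_csSup (bddAbove_kappaSet hd hE) hmem)
  nlinarith

end ContinuedFraction

/-! ### Binary Hermitian forms -/

namespace BinHermForm

theorem eval_smul (H : BinHermForm) (c z w : ℂ) :
    H.eval (c * z) (c * w) = Complex.normSq c * H.eval z w := by
  simp [eval, Complex.normSq_apply]
  ring

/-- The form `(u, v) ↦ H (p u + p' v, q u + q' v)`. -/
def transform (H : BinHermForm) (p p' q q' : ℂ) : BinHermForm where
  A := H.eval p q
  B := -H.A * conj p * p' + H.B * conj p * q' + conj H.B * conj q * p' - H.C * conj q * q'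
  C := H.eval p' q'

theorem eval_transform (H : BinHermForm) (p p' q q' u v : ℂ) :
    (H.transform p p' q q').eval u v = H.eval (p * u + p' * v) (q * u + q' * v) := by
  simp [eval, transform, Complex.normSq_apply]
  ring

theorem disc_transform (H : BinHermForm) (p p' q q' : ℂ) :
    (H.transform p p' q q').disc = Complex.normSq (p * q' - p' * q) * H.disc := by
  simp [disc, eval, transform, Complex.normSq_apply]
  ring

/-- Completing the square: A·H(z, 1) = |Az - B|² + Δ. -/
theorem norm_sub_sq_of_eval_eq_zero (H : BinHermForm) {z : ℂ} (hz : H.eval z 1 = 0) :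
    ‖H.A * z - H.B‖ ^ 2 = -H.disc := by
  rw [← Complex.normSq_eq_norm_sq]
  simp [eval, disc, Complex.normSq_apply] at hz ⊢
  linear_combination H.A * hz

theorem disc_nonpos_of_eval_eq_zero (H : BinHermForm) {z : ℂ} (hz : H.eval z 1 = 0) :
    H.disc ≤ 0 := by
  have := H.norm_sub_sq_of_eval_eq_zero hz
  nlinarith [sq_nonneg ‖H.A * z - H.B‖]

theorem norm_sub_of_eval_eq_zero (H : BinHermForm) {z : ℂ} (hz : H.eval z 1 = 0) :
    ‖H.A * z - H.B‖ = √(-H.disc) := by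
  rw [← H.norm_sub_sq_of_eval_eq_zero hz, Real.sqrt_sq (norm_nonneg _)]

theorem norm_le_of_eval_eq_zero (H : BinHermForm) {z : ℂ} (hz : H.eval z 1 = 0)
    (hA : 1 ≤ |H.A|) : ‖z‖ ≤ √(-H.disc) + ‖H.B‖ := by
  calc ‖z‖ ≤ |H.A| * ‖z‖ := le_mul_of_one_le_left (norm_nonneg _) hA
    _ = ‖(H.A * z - H.B) + H.B‖ := by
      rw [sub_add_cancel, norm_mul, Complex.norm_real, Real.norm_eq_abs]
    _ ≤ √(-H.disc) + ‖H.B‖ := by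
      rw [← H.norm_sub_of_eval_eq_zero hz]
      exact norm_add_le _ _

theorem abs_eval_le_of_eval_eq_zero (H : BinHermForm) {z : ℂ} (hz : H.eval z 1 = 0) (p q : ℂ) :
    |H.eval p q| ≤ |H.A| * ‖q * z - p‖ ^ 2 + 2 * √(-H.disc) * (‖q‖ * ‖q * z - p‖) := by
  -- Expand H at (p, q) = (qz, q) - (qz - p, 0); the term |q|² H(z, 1) vanishes.
  have h : H.eval p q = H.A * ‖q * z - p‖ ^ 2 +
      -(2 * (conj (q * z - p) * (q * (H.A * z - H.B))).re) := by
    have := H.eval_smul q z 1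
    rw [hz] at this
    rw [← Complex.normSq_eq_norm_sq]
    simp [eval, Complex.normSq_apply] at this ⊢
    linear_combination this
  rw [h]
  refine (abs_add_le _ _).trans ?_
  rw [abs_mul, abs_neg, abs_mul, abs_of_nonneg (sq_nonneg ‖q * z - p‖), abs_two]
  have h2 := Complex.abs_re_le_norm (conj (q * z - p) * (q * (H.A * z - H.B)))
  rw [norm_mul, norm_mul, Complex.norm_conj, H.norm_sub_of_eval_eq_zero hz] at h2
  nlinarith

/-! ### Integral anisotropic forms: values at convergents and Liouville's inequality -/

variable {d : ℕ} {E : Set ℂ} {H : BinHermForm}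

theorem IsIntegralOver.one_le_abs_eval (hH : H.IsIntegralOver d) (ha : H.IsAnisotropic d) {p q : ℂ}
    (hp : p ∈ quadInt d) (hq : q ∈ quadInt d) (h0 : ¬(p = 0 ∧ q = 0)) : 1 ≤ |H.eval p q| := by
  obtain ⟨⟨a, hA⟩, ⟨c, hC⟩, hB⟩ := hH
  obtain ⟨k, hk⟩ := exists_int_normSq hp
  obtain ⟨l, hl⟩ := exists_int_normSq hq
  obtain ⟨m, hm⟩ := exists_int_two_mul_re (mul_mem (mul_mem hB (conj_mem_quadInt hp)) hq)
  have heval : H.eval p q = ((a * k - m + c * l : ℤ) : ℝ) := by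
    rw [eval, hA, hC, hk, hl, hm]
    push_cast
    ring
  have hne : H.eval p q ≠ 0 := fun h => h0 (ha p hp.2 q hq.2 h)
  rw [heval] at hne ⊢
  exact_mod_cast Int.one_le_abs (Int.cast_ne_zero.1 hne)

theorem eval_one_zero (H : BinHermForm) : H.eval 1 0 = H.A := by simp [eval]

theorem one_le_abs_A (hH : H.IsIntegralOver d) (ha : H.IsAnisotropic d) : 1 ≤ |H.A| := by
  rw [← H.eval_one_zero]
  exact hH.one_le_abs_eval ha (one_mem _) (zero_mem _) (by simp)

theorem IsAnisotropic.not_mem_quadField (ha : H.IsAnisotropic d) {z : ℂ} (hz : z ∈ H.zeroSet) :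
    z ∉ quadField d :=
  fun h => one_ne_zero (ha z h 1 (one_mem _) hz).2

theorem abs_eval_convergent_le (hd : d ∈ ({1, 2, 3, 7, 11} : Set ℕ)) (hE : IsBoundaryChoice d E)
    (ha : H.IsAnisotropic d) {z : ℂ} (hz : z ∈ H.zeroSet) (n : ℕ) :
    |H.eval (cfMat d E z n 0 0) (cfMat d E z n 1 0)| ≤ H.eta d E := by
  have hzK := ha.not_mem_quadField hz
  have hk : ‖cfDen d E z n‖ * ‖cfDen d E z n * z - cfNum d E z n‖ ≤ kappa d E :=
    le_csSup (bddAbove_kappaSet hd hE) ⟨z, hzK, n, rfl⟩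
  have hk0 : 0 ≤ kappa d E := by linarith [one_fourth_le_kappa hd hE]
  by_cases hq : cfMat d E z n 1 0 = 0
  -- If q_n = 0, the unit determinant forces |p_n| = 1, so the value is A; hence |A| in the maximum
  -- defining η.
  · have hdet := norm_det_cfMat (d := d) (E := E) z n
    rw [Matrix.det_fin_two, hq, mul_zero, sub_zero, norm_mul] at hdet
    have hp0 : cfMat d E z n 0 0 ≠ 0 := by
      intro h
      simp [h] at hdet
    have hp1 : cfMat d E z n 1 1 ≠ 0 := by
      intro h
      simp [h] at hdet
    have h1 := one_le_norm_of_mem_quadInt (cfMat_mem hE z n 0 0) hp0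
    have h2 := one_le_norm_of_mem_quadInt (cfMat_mem hE z n 1 1) hp1
    have h3 : ‖cfMat d E z n 0 0‖ = 1 := by nlinarith
    have h4 : H.eval (cfMat d E z n 0 0) 0 = H.A := by
      simp [eval, Complex.normSq_eq_norm_sq, h3]
    rw [hq, h4]
    exact le_max_left _ _
  · have hq1 := one_le_norm_of_mem_quadInt (cfMat_mem hE z n 1 0) hq
    have hδ : ‖cfDen d E z n * z - cfNum d E z n‖ ≤ kappa d E :=
      (le_mul_of_one_le_left (norm_nonneg _) hq1).trans hk
    refine (H.abs_eval_le_of_eval_eq_zero hz _ _).trans (le_trans ?_ (le_max_right _ _))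
    have hB := mul_nonneg (norm_nonneg H.B) hk0
    calc |H.A| * ‖cfDen d E z n * z - cfNum d E z n‖ ^ 2 +
          2 * √(-H.disc) * (‖cfDen d E z n‖ * ‖cfDen d E z n * z - cfNum d E z n‖)
        ≤ |H.A| * kappa d E ^ 2 + 2 * √(-H.disc) * kappa d E := by gcongr
      _ ≤ _ := by linarith

theorem abs_eval_previous_convergent_le (hd : d ∈ ({1, 2, 3, 7, 11} : Set ℕ))
    (hE : IsBoundaryChoice d E) (ha : H.IsAnisotropic d) {z : ℂ} (hz : z ∈ H.zeroSet) (n : ℕ) :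
    |H.eval (cfMat d E z n 0 1) (cfMat d E z n 1 1)| ≤ H.eta d E := by
  cases n with
  | zero =>
    have h : H.eval (cfMat d E z 0 0 1) (cfMat d E z 0 1 1) = H.A := by simp [cfMat, eval]
    rw [h]
    exact le_max_left _ _
  | succ n =>
    rw [cfMat_succ_one, cfMat_succ_one]
    exact abs_eval_convergent_le hd hE ha hz n

theorem norm_inv_cfRem_le (hd : d ∈ ({1, 2, 3, 7, 11} : Set ℕ)) (hE : IsBoundaryChoice d E)
    (hH : H.IsIntegralOver d) (ha : H.IsAnisotropic d) {z : ℂ} (hz : z ∈ H.zeroSet) (n : ℕ) :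
    ‖1 / cfRem d E z n‖ ≤ √(-H.disc) + √(H.eta d E ^ 2 - H.disc) := by
  have hzK := ha.not_mem_quadField hz
  have ht := cfRem_ne_zero hE hzK n
  have hA' := abs_eval_convergent_le hd hE ha hz n
  have hC' := abs_eval_previous_convergent_le hd hE ha hz n
  have hdet := norm_det_cfMat (d := d) (E := E) z n
  rw [Matrix.det_fin_two] at hdet
  set H' := H.transform (cfMat d E z n 0 0) (cfMat d E z n 0 1) (cfMat d E z n 1 0)
    (cfMat d E z n 1 1) with hH'
  have hdisc : H'.disc = H.disc := by
    rw [hH', disc_transform, Complex.normSq_eq_norm_sq, hdet, one_pow, one_mul]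
  -- The convergent matrix sends (1, z_n) to a multiple of (z, 1).
  have hzero : H'.eval (1 / cfRem d E z n) 1 = 0 := by
    have h1 : H'.eval 1 (cfRem d E z n) = 0 := by
      rw [hH', eval_transform, mul_one, mul_one, cfMat_mul_cfRem hE hzK n]
      have := H.eval_smul (cfMat d E z n 1 0 + cfMat d E z n 1 1 * cfRem d E z n) z 1
      rw [mul_one, mul_comm _ z] at this
      rw [this, show H.eval z 1 = 0 from hz, mul_zero]
    have h2 := H'.eval_smul (1 / cfRem d E z n) 1 (cfRem d E z n)
    rwa [h1, mul_zero, mul_one, one_div_mul_cancel ht] at h2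
  have hone : 1 ≤ |H'.A| := by
    refine hH.one_le_abs_eval ha (cfMat_mem hE z n 0 0) (cfMat_mem hE z n 1 0) ?_
    rintro ⟨h1, h2⟩
    rw [h1, h2] at hdet
    simp at hdet
  have hB : ‖H'.B‖ ≤ √(H.eta d E ^ 2 - H.disc) := by
    refine Real.le_sqrt_of_sq_le ?_
    have h : ‖H'.B‖ ^ 2 = H'.A * H'.C - H.disc := by
      rw [← hdisc, disc, Complex.normSq_eq_norm_sq]
      ring
    have h3 : H'.A * H'.C ≤ H.eta d E * H.eta d E :=
      (le_abs_self _).trans (by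
        rw [abs_mul]
        exact mul_le_mul hA' hC' (abs_nonneg _) ((abs_nonneg _).trans hA'))
    rw [h]
    nlinarith
  have := H'.norm_le_of_eval_eq_zero hzero hone
  rw [hdisc] at this
  linarith

theorem one_le_eta (hH : H.IsIntegralOver d) (ha : H.IsAnisotropic d) : 1 ≤ H.eta d E :=
  (one_le_abs_A hH ha).trans (le_max_left _ _)

/-- Serves the case n = 0 of the partial quotient bound, where z plays the role of 1/z_{n-1}. -/
theorem norm_le_of_mem_zeroSet (hd : d ∈ ({1, 2, 3, 7, 11} : Set ℕ)) (hE : IsBoundaryChoice d E)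
    (hH : H.IsIntegralOver d) (ha : H.IsAnisotropic d) {z : ℂ} (hz : z ∈ H.zeroSet) :
    ‖z‖ ≤ √(-H.disc) + √(H.eta d E ^ 2 - H.disc) := by
  refine (H.norm_le_of_eval_eq_zero hz (one_le_abs_A hH ha)).trans ?_
  gcongr
  have hκ := one_fourth_le_kappa hd hE
  have hB : ‖H.B‖ ≤ H.eta d E := by
    refine le_trans ?_ (le_max_right _ _)
    have h1 : 0 ≤ |H.A| * kappa d E ^ 2 := by positivity
    have h2 : 0 ≤ 2 * kappa d E * √(-H.disc) := by positivity
    nlinarith [norm_nonneg H.B]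
  refine Real.le_sqrt_of_sq_le ?_
  have := H.disc_nonpos_of_eval_eq_zero hz
  nlinarith [norm_nonneg H.B]

theorem norm_cfQuot_le (hd : d ∈ ({1, 2, 3, 7, 11} : Set ℕ)) (hE : IsBoundaryChoice d E)
    (hH : H.IsIntegralOver d) (ha : H.IsAnisotropic d) {z : ℂ} (hz : z ∈ H.zeroSet) (n : ℕ) :
    ‖cfQuot d E z n‖ ≤ rho d + √(-H.disc) + √(H.eta d E ^ 2 - H.disc) := by
  have hrem := hE.norm_le_rho hd (hE.cfRem_mem z n)
  cases n with
  | zero =>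
    have h : cfQuot d E z 0 = z - cfRem d E z 0 := by simp [cfQuot, cfRem]
    rw [h]
    linarith [norm_sub_le z (cfRem d E z 0), norm_le_of_mem_zeroSet hd hE hH ha hz]
  | succ n =>
    have h : cfQuot d E z (n + 1) = 1 / cfRem d E z n - cfRem d E z (n + 1) := by
      rw [cfRem_succ]
      ring
    rw [h]
    linarith [norm_sub_le (1 / cfRem d E z n) (cfRem d E z (n + 1)),
      norm_inv_cfRem_le hd hE hH ha hz n]

theorem one_le_mul_norm_mul (hH : H.IsIntegralOver d) (ha : H.IsAnisotropic d) {z : ℂ}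
    (hz : z ∈ H.zeroSet) {p q : ℂ} (hp : p ∈ quadInt d) (hq : q ∈ quadInt d) (h0 : q ≠ 0) :
    1 ≤ (√(-H.disc) + √(H.eta d E ^ 2 - H.disc)) * (‖q‖ * ‖q * z - p‖) := by
  have h1 := hH.one_le_abs_eval ha hp hq (fun h => h0 h.2)
  have h2 := H.abs_eval_le_of_eval_eq_zero hz p q
  have hq1 := one_le_norm_of_mem_quadInt hq h0
  -- Since η ≥ 1, |A| may be replaced by η² = t² - s², which lets the quadratic inequality below
  -- factor.
  have hA : |H.A| ≤ H.eta d E ^ 2 := by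
    have h3 : |H.A| ≤ H.eta d E := le_max_left _ _
    nlinarith [one_le_eta (E := E) hH ha]
  have hD := H.disc_nonpos_of_eval_eq_zero hz
  have hs := Real.sq_sqrt (neg_nonneg.2 hD)
  have ht := Real.sq_sqrt (show 0 ≤ H.eta d E ^ 2 - H.disc by nlinarith [sq_nonneg (H.eta d E)])
  have hs0 := Real.sqrt_nonneg (-H.disc)
  have ht0 := Real.sqrt_nonneg (H.eta d E ^ 2 - H.disc)
  set s := √(-H.disc)
  set t := √(H.eta d E ^ 2 - H.disc)
  set y := ‖q * z - p‖
  have hy0 : 0 ≤ y := norm_nonneg _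
  have hx0 : 0 ≤ ‖q‖ * y := by positivity
  have hxy : y ^ 2 ≤ (‖q‖ * y) ^ 2 :=
    pow_le_pow_left₀ hy0 (le_mul_of_one_le_left hy0 hq1) 2
  have h4 : 1 ≤ (t ^ 2 - s ^ 2) * (‖q‖ * y) ^ 2 + 2 * s * (‖q‖ * y) := by
    have : |H.A| * y ^ 2 ≤ (t ^ 2 - s ^ 2) * (‖q‖ * y) ^ 2 :=
      mul_le_mul (by linarith) hxy (by positivity) (by nlinarith [abs_nonneg H.A])
    linarith
  by_contra! hlt
  -- With x = |q| y, `h4` says (1 - s x)² ≤ (t x)², whereas (s + t) x < 1 gives 0 ≤ t x < 1 - s x.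
  have h5 : (t * (‖q‖ * y)) ^ 2 < (1 - s * (‖q‖ * y)) ^ 2 :=
    pow_lt_pow_left₀ (by linarith) (by positivity) two_ne_zero
  linarith

end BinHermForm

/-! ### The constants α and the conclusion -/

theorem one_le_alpha {d : ℕ} (hd : d ∈ ({1, 2, 3, 7, 11} : Set ℕ)) : 1 ≤ alpha d := by
  -- Except for α = 2 at d = 3, each α is 1/(t - 1), so it suffices that 1 < t ≤ 2.
  have key {t : ℝ} (h0 : 1 < t) (h1 : t ≤ 2) : 1 ≤ 1 / (t - 1) := by
    rw [le_div_iff₀ (by linarith)]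
    linarith
  have key' {x : ℝ} (h0 : 1 / 2 < x) (h1 : x ≤ 1) : 1 ≤ 1 / (√2 * √x - 1) := by
    rw [← Real.sqrt_mul zero_le_two]
    exact key (Real.lt_sqrt_of_sq_lt (by linarith))
      (Real.sqrt_le_iff.2 ⟨zero_le_two, by linarith⟩)
  have root {x a b : ℝ} (ha : 0 ≤ a) (hb : 0 ≤ b) (h1 : a ^ 2 ≤ x) (h2 : x ≤ b ^ 2) :
      a ≤ √x ∧ √x ≤ b := ⟨Real.le_sqrt_of_sq_le h1, Real.sqrt_le_iff.2 ⟨hb, h2⟩⟩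
  rcases hd with rfl | rfl | rfl | rfl | rfl <;> simp only [alpha] <;> norm_num only [if_true, if_false]
  · have := root (x := 2) (a := 1.1) (b := 2) (by norm_num) (by norm_num) (by norm_num) (by norm_num)
    exact key (by linarith) (by linarith)
  · have := root (x := 3) (a := 1) (b := 2) (by norm_num) (by norm_num) (by norm_num) (by norm_num)
    exact key' (by linarith) (by linarith)
  · have := root (x := 21) (a := 4) (b := 5) (by norm_num) (by norm_num) (by norm_num) (by norm_num)
    exact key' (by linarith) (by linarith)
  -- For d = 11, t is only about 1.033, so the square roots need tighter brackets.
  · obtain ⟨a5, b5⟩ := root (x := 5) (a := 2.236) (b := 2.237) (by norm_num) (by norm_num)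
      (by norm_num) (by norm_num)
    obtain ⟨a11, b11⟩ := root (x := 11) (a := 3.316) (b := 3.317) (by norm_num) (by norm_num)
      (by norm_num) (by norm_num)
    obtain ⟨a55, b55⟩ := root (x := 55) (a := 7.416) (b := 7.417) (by norm_num) (by norm_num)
      (by norm_num) (by norm_num)
    obtain ⟨a2, b2⟩ := root (x := 2) (a := 1.414) (b := 1.415) (by norm_num) (by norm_num)
      (by norm_num) (by norm_num)
    obtain ⟨a3, b3⟩ := root (x := 3) (a := 1.732) (b := 1.733) (by norm_num) (by norm_num)
      (by norm_num) (by norm_num)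
    obtain ⟨ax, bx⟩ := root (x := 30 - 8 * √5 - 5 * √11 + 3 * √55) (a := 4.2) (b := 4.3)
      (by norm_num) (by norm_num) (by linarith) (by linarith)
    set X := √(30 - 8 * √5 - 5 * √11 + 3 * √55)
    have h2 : 0 < 5 * √2 := by linarith
    have e : √3 * (1 / (5 * √2) * X) = √3 * X / (5 * √2) := by ring
    rw [e]
    refine key ?_ ?_
    · rw [lt_div_iff₀ h2]
      nlinarith
    · rw [div_le_iff₀ h2]
      nlinarith

theorem mainTheorem5 (d : ℕ) (hd : d ∈ ({1, 2, 3, 7, 11} : Set ℕ))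
    (E : Set ℂ) (hE : IsBoundaryChoice d E) :
    BddAbove (kappaSet d E) ∧
    ∀ H : BinHermForm, H.IsIntegralOver d → H.IsIndefinite → H.IsAnisotropic d →
      (∀ z ∈ H.zeroSet, ∀ n : ℕ,
        1 / (√(-H.disc) + √(H.eta d E ^ 2 - H.disc)) ≤ ‖cfRem d E z n‖ ∧
        ‖cfQuot d E z n‖ ≤ rho d + √(-H.disc) + √(H.eta d E ^ 2 - H.disc)) ∧
      0 < H.approxConst d E ∧
      ∀ z ∈ H.zeroSet, ∀ p ∈ quadInt d, ∀ q ∈ quadInt d, q ≠ 0 →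
        H.approxConst d E / ‖q‖ ^ 2 ≤ ‖z - p / q‖ := by
  refine ⟨bddAbove_kappaSet hd hE, fun H hH _ ha => ?_⟩
  have hα := one_le_alpha hd
  have hρ := rho_nonneg d
  have hs0 := Real.sqrt_nonneg (-H.disc)
  have ht0 := Real.sqrt_nonneg (H.eta d E ^ 2 - H.disc)
  have hβ : √(-H.disc) + √(H.eta d E ^ 2 - H.disc) ≤ H.beta d E + 1 := by
    rw [BinHermForm.beta]
    linarith
  have hβ0 : 0 ≤ H.beta d E := by
    rw [BinHermForm.beta]
    linarith
  have hpos : 0 < alpha d * (H.beta d E + 1) * (H.beta d E + rho d + 1) := by positivity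
  -- One factor β + 1 already dominates √(-Δ) + √(η² - Δ); the factors α and β + ρ + 1 are at least
  -- 1.
  have hle : √(-H.disc) + √(H.eta d E ^ 2 - H.disc) ≤
      alpha d * (H.beta d E + 1) * (H.beta d E + rho d + 1) := by
    refine hβ.trans ?_
    calc H.beta d E + 1 ≤ alpha d * (H.beta d E + 1) :=
          le_mul_of_one_le_left (by positivity) hα
      _ ≤ _ := le_mul_of_one_le_right (by positivity) (by linarith)
  refine ⟨fun z hz n => ⟨?_, BinHermForm.norm_cfQuot_le hd hE hH ha hz n⟩, one_div_pos.2 hpos,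
    fun z hz p hp q hq h0 => ?_⟩
  · have ht : 0 < ‖cfRem d E z n‖ :=
      norm_pos_iff.2 (cfRem_ne_zero hE (ha.not_mem_quadField hz) n)
    have h := BinHermForm.norm_inv_cfRem_le hd hE hH ha hz n
    rw [norm_div, norm_one] at h
    exact (one_div_le ((one_div_pos.2 ht).trans_le h) ht).2 h
  · have hq0 : 0 < ‖q‖ := norm_pos_iff.2 h0
    have h1 := BinHermForm.one_le_mul_norm_mul (E := E) hH ha hz hp hq h0
    have h2 : ‖q * z - p‖ = ‖q‖ * ‖z - p / q‖ := by
      rw [← norm_mul, mul_sub, mul_div_cancel₀ _ h0]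
    rw [BinHermForm.approxConst, div_le_iff₀ (by positivity), div_le_iff₀ hpos]
    have h3 : 0 ≤ ‖q‖ * ‖q * z - p‖ := by positivity
    calc (1 : ℝ) ≤ _ := h1
      _ ≤ alpha d * (H.beta d E + 1) * (H.beta d E + rho d + 1) * (‖q‖ * ‖q * z - p‖) := by gcongr
      _ = _ := by rw [h2]; ring
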